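/- **Theorem.** For a commutative ring $R$, an integer $n\ge 1$ and a power series $f=\sum_{\boldsymbol i\in\mathbb N^n}a(i_1,\dots,i_n)\,t_1^{i_1}\cdots t_n^{i_n}\in R[\![\boldsymbol t]\!]=R[\![t_1,\dots,t_n]\!]$, the *diagonal* of $f$ is $\Delta(f)=\sum_{i\ge 0}a(i,\dots,i)\,t^i\in R[\![t]\!]$; for an ideal $\mathfrak p$ of $R$ and $g\in R[\![t]\!]$, let $g_{|\mathfrak p}\in (R/\mathfrak p)[\![t]\!]$ be the series obtained by reducing every coefficient modulo $\mathfrak p$. If $k$ is a field and $f\in k[\![\boldsymbol t]\!]$ is algebraic over $k(\boldsymbol t)$, let $E(\boldsymbol t,y)\in k[\boldsymbol t,y]$ be a nonzero polynomial with $E(\boldsymbol t,f)=0$ that is minimal for divisibility (it is unique up to a factor in $k^\times$). The *degree* of $f$ is the degree of $E$ in $y$, its *total height* is the total degree of $E$ in $\boldsymbol t$, and its *partial height* is $(h_1,\dots,h_n)$, where $h_i$ is the degree of $E$ in $t_i$. Let $k$ be a field of characteristic zero, let $Z\subset k$ be a subring that is finitely generated as a $\mathbb Z$-algebra, let $n\ge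 1$, and let $f\in Z[\![t_1,\dots,t_n]\!]$ be algebraic over $k(\boldsymbol t)$ with degree $d$, total height $h$ and partial height $(h_1,\dots,h_n)$. Set $$N=(d+1)\cdot\min\left\{\prod_{i=1}^n(h_i+1)-\prod_{i=1}^n h_i,\ \binom{n+h}{n}-\binom{h}{n}\right\}.$$ Then, for every maximal ideal $\mathfrak p$ of $Z$, with $p$ the characteristic of $Z/\mathfrak p$, the series $\Delta(f)_{|\mathfrak p}$ is annihilated by a linearized polynomial of $p$-degree at most $N$ with coefficients in $(Z/\mathfrak p)(t)$, that is, by a polynomial $c_0X+c_1X^p+\cdots+c_MX^{p^M}$ with $M\le N$, $c_i\in (Z/\mathfrak p)(t)$ and $c_M\ne 0$. In particular, $\Delta(f)_{|\mathfrak p}$ is algebraic over $(Z/\mathfrak p)(t)$ of degree at most $p^N-1$. -/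

import Mathlib

noncomputable section

namespace DiagonalModP

open scoped RatFunc

/-- The diagonal of a power series in `n` variables: the coefficient of `t ^ i` in `diagonal f`
is the coefficient of `t₁ ^ i * ⋯ * tₙ ^ i` in `f`. -/
def diagonal {R : Type*} [CommRing R] {n : ℕ} (f : MvPowerSeries (Fin n) R) : PowerSeries R :=
  PowerSeries.mk fun i => MvPowerSeries.coeff (Finsupp.equivFunOnFinite.symm fun _ => i) f

/-- The reduction of a univariate power series modulo an ideal, coefficient by coefficient. -/
def reduction {R : Type*} [CommRing R] (I : Ideal R) (g : PowerSeries R) : PowerSeries (R ⧸ I) :=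
  PowerSeries.map (Ideal.Quotient.mk I) g

/-- `E ∈ k[t₁, …, tₙ][y]` is a nonzero polynomial with `E(t, f) = 0` which is minimal for
divisibility among all such polynomials. -/
def IsMinimalEquation {k : Type*} [Field k] {n : ℕ} (f : MvPowerSeries (Fin n) k)
    (E : Polynomial (MvPolynomial (Fin n) k)) : Prop :=
  E ≠ 0 ∧ Polynomial.aeval f E = 0 ∧
    ∀ Q : Polynomial (MvPolynomial (Fin n) k), Q ≠ 0 → Polynomial.aeval f Q = 0 → Q ∣ E → E ∣ Q

/-- The total degree in `t₁, …, tₙ` of `E ∈ k[t₁, …, tₙ][y]`. -/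
def totalDegreeT {k : Type*} [Field k] {n : ℕ} (E : Polynomial (MvPolynomial (Fin n) k)) : ℕ :=
  E.support.sup fun j => (E.coeff j).totalDegree

/-- The degree in `tᵢ` of `E ∈ k[t₁, …, tₙ][y]`. -/
def degreeOfT {k : Type*} [Field k] {n : ℕ} (i : Fin n)
    (E : Polynomial (MvPolynomial (Fin n) k)) : ℕ :=
  E.support.sup fun j => (E.coeff j).degreeOf i

/-- The power series `f` has degree `d`, total height `h` and partial height `hs`: these are the
degree in `y`, the total degree in `t₁, …, tₙ`, and the tuple of the degrees in each `tᵢ` of a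
minimal equation of `f` (which is unique up to a nonzero constant of `k`). -/
def HasDegreeAndHeights {k : Type*} [Field k] {n : ℕ} (f : MvPowerSeries (Fin n) k)
    (d h : ℕ) (hs : Fin n → ℕ) : Prop :=
  ∃ E : Polynomial (MvPolynomial (Fin n) k), IsMinimalEquation f E ∧
    E.natDegree = d ∧ totalDegreeT E = h ∧ ∀ i, degreeOfT i E = hs i

/-- The number `N`. Neither of the two subtractions truncates. -/
def boundN (n d h : ℕ) (hs : Fin n → ℕ) : ℕ :=
  (d + 1) * min (∏ i, (hs i + 1) - ∏ i, hs i) ((n + h).choose n - h.choose n)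

/-- `P = c₀ X + c₁ X ^ p + ⋯ + c_M X ^ (p ^ M)` with `c_M ≠ 0`: a linearized polynomial
of `p`-degree `M`. -/
def IsLinearizedOfPDegree {K : Type*} [Field K] (p M : ℕ) (P : Polynomial K) : Prop :=
  ∃ c : ℕ → K, c M ≠ 0 ∧
    P = ∑ i ∈ Finset.range (M + 1), Polynomial.C (c i) * Polynomial.X ^ (p ^ i)

/-- The power series `g ∈ F⟦t⟧`, seen in the field `F((t))` of Laurent series, which is an
extension of the field `F(t)` of rational functions. -/
def toLaurent {F : Type*} [Field F] (g : PowerSeries F) : LaurentSeries F :=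
  HahnSeries.ofPowerSeries ℤ F g

/-- The polynomial `P` with coefficients in `F(t)` annihilates the power series `g ∈ F⟦t⟧`. -/
def Annihilates {F : Type*} [Field F] (P : Polynomial (RatFunc F)) (g : PowerSeries F) : Prop :=
  Polynomial.aeval (toLaurent g) P = 0

/-- The power series `g ∈ F⟦t⟧` is annihilated by a linearized polynomial with coefficients
in `F(t)` of `p`-degree at most `N`. -/
def HasLinearizedAnnihilator {F : Type*} [Field F] (p N : ℕ) (g : PowerSeries F) : Prop :=
  ∃ M ≤ N, ∃ P : Polynomial (RatFunc F), IsLinearizedOfPDegree p M P ∧ Annihilates P g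

/-- The power series `g ∈ F⟦t⟧` is algebraic over `F(t)`, of degree at most `m`. -/
def IsAlgebraicOfDegreeLE {F : Type*} [Field F] (g : PowerSeries F) (m : ℕ) : Prop :=
  IsAlgebraic (RatFunc F) (toLaurent g) ∧ (minpoly (RatFunc F) (toLaurent g)).natDegree ≤ m

end DiagonalModP

end

namespace DiagonalModP

/-! ### Cartier operators on power series over a perfect field. -/

section Cartier

open MvPowerSeries

variable {σ F : Type*} [Field F] (p : ℕ) [Fact p.Prime] [CharP F p]

/-! As `Z` is of finite type over `ℤ`, the field `F = Z/𝔭` is finite, hence perfect, and Cartier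
operators `S_r` are available over it. A nonzero equation of `f` over `k` yields a nonzero equation
of the reduction of `f`, again called `f`, with no new monomials, since ranks do not grow under
reduction (`exists_linear_relation_map`). Among such equations, one of least degree `E` has `f` as a
simple root (`exists_eval_derivative_ne_zero`).

Let `W` be the set of power series `P(f) / E'(f)` with `deg_y P ≤ d` and the exponents of `P`
bounded by the heights (`residueSpace`). It contains `f`. It is stable under every `S_r` with
entries below `p`: `S_r(P(f) / E'(f)) = C_r(P E^(p-1))(f) / E'(f)`, which is the action of the
Cartier operator on the residue of `P / E` at `y = f`, and `C_r` divides by `p` the bounds on `P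
E^(p-1)`.

Multiplication by `E'(f)` sends `W` into the `F[t₁⋯tₙ]`-module generated by the `t^b f^j` with `j ≤
d` and `b` an allowed exponent having a zero coordinate; `N` bounds the number of these generators.
As `Δ` turns multiplication by `t₁⋯tₙ` into multiplication by `t`, the diagonals of `W` span an
`F(t)`-space of dimension at most `N`.

Finally `Δ(w) = ∑_{r<p} t^r Δ(S_(r,…,r) w)^p` puts `Δ(W)` in the span of its own `p`-th powers. If
`m ≤ N` independent diagonals span `Δ(W)`, iteration puts `Δ(f), Δ(f)^p, …, Δ(f)^(p^m)` in the span
of their `m` powers of exponent `p^m`, and these `m + 1` series are dependent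
(`exists_sum_smul_pow_eq_zero`). -/

instance charP_mvPowerSeries : CharP (MvPowerSeries σ F) p :=
  charP_of_injective_ringHom (f := MvPowerSeries.C (σ := σ) (R := F))
    (MvPowerSeries.C_injective) p

theorem coeff_pow_char (a : MvPowerSeries σ F) (m : σ →₀ ℕ) :
    coeff (p • m) (a ^ p) = coeff m a ^ p := by
  rw [← MvPowerSeries.map_frobenius_expand p (NeZero.ne p), coeff_map, coeff_expand_smul,
    frobenius_def]

theorem coeff_pow_char_of_not_dvd (a : MvPowerSeries σ F) {m : σ →₀ ℕ} {i : σ} (h : ¬ p ∣ m i) :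
    coeff m (a ^ p) = 0 := by
  rw [← MvPowerSeries.map_frobenius_expand p (NeZero.ne p), coeff_map,
    coeff_expand_of_not_dvd _ _ _ h, map_zero]

variable [PerfectRing F p]

/-- The Cartier operator (or section) of index `r`: it extracts the coefficients of the exponents
`p • m + r` and takes their `p`-th roots. -/
noncomputable def cartier (r : σ →₀ ℕ) : MvPowerSeries σ F →+ MvPowerSeries σ F where
  toFun a := fun m => (frobeniusEquiv F p).symm (coeff (p • m + r) a)
  map_zero' := funext fun _ => map_zero _
  map_add' _ _ := funext fun _ => map_add (frobeniusEquiv F p).symm _ _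

theorem coeff_cartier (r m : σ →₀ ℕ) (a : MvPowerSeries σ F) :
    coeff m (cartier p r a) = (frobeniusEquiv F p).symm (coeff (p • m + r) a) := rfl

theorem coeff_cartier_pow (r m : σ →₀ ℕ) (a : MvPowerSeries σ F) :
    coeff m (cartier p r a) ^ p = coeff (p • m + r) a := by
  rw [coeff_cartier, ← frobenius_def, frobenius_apply_frobeniusEquiv_symm]

variable [Finite σ]

/-- Only exponents divisible by `p` occur in `a ^ p`, so the decompositions of `p • m + r` that
contribute are `(p • u, p • v + r)` with `u + v = m`. -/
theorem cartier_pow_mul {r : σ →₀ ℕ} (hr : ∀ i, r i < p) (a b : MvPowerSeries σ F) :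
    cartier p r (a ^ p * b) = a * cartier p r b := by
  classical
  ext m
  have hp : 0 < p := (Fact.out : p.Prime).pos
  rw [coeff_cartier, RingEquiv.symm_apply_eq, frobeniusEquiv_apply, frobenius_def, coeff_mul,
    coeff_mul, sum_pow_char]
  symm
  refine Finset.sum_of_injOn (fun x => (p • x.1, p • x.2 + r)) ?_ ?_ ?_ ?_
  · rintro ⟨u, v⟩ - ⟨u', v'⟩ - h
    simp only [Prod.mk.injEq, add_left_inj] at h
    have hinj : Function.Injective fun x : σ →₀ ℕ => p • x := fun x y hxy => by
      ext i
      exact Nat.eq_of_mul_eq_mul_left hp (by simpa using DFunLike.congr_fun hxy i)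
    exact Prod.ext (hinj h.1) (hinj h.2)
  · rintro ⟨u, v⟩ h
    rw [Finset.mem_coe, Finset.HasAntidiagonal.mem_antidiagonal] at h ⊢
    rw [← h, smul_add, add_assoc]
  · rintro ⟨u, v⟩ h hnot
    rw [Finset.HasAntidiagonal.mem_antidiagonal] at h
    by_cases hu : ∀ i, p ∣ u i
    · exfalso
      apply hnot
      choose w hw using hu
      -- This is where `r i < p` matters: `p * w i ≤ p * m i + r i < p * (m i + 1)`.
      have hle : ∀ i, w i ≤ m i := fun i => by
        have := DFunLike.congr_fun h i
        simp only [Finsupp.add_apply, Finsupp.smul_apply, smul_eq_mul, hw] at this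
        have h1 := hr i
        by_contra hlt
        have h2 : p * (m i + 1) ≤ p * w i := Nat.mul_le_mul_left _ (by omega)
        rw [mul_add] at h2
        omega
      refine ⟨(Finsupp.equivFunOnFinite.symm w, m - Finsupp.equivFunOnFinite.symm w), ?_, ?_⟩
      · rw [Finset.mem_coe, Finset.HasAntidiagonal.mem_antidiagonal]
        ext i
        simpa using Nat.add_sub_cancel' (hle i)
      · refine Prod.ext ?_ ?_
        · ext i; simp [hw]
        · ext i
          have := DFunLike.congr_fun h i
          simp only [Finsupp.add_apply, Finsupp.smul_apply, smul_eq_mul, hw] at this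
          have h1 : p * w i ≤ p * m i := Nat.mul_le_mul_left _ (hle i)
          simp [Nat.mul_sub]
          omega
    · push Not at hu
      obtain ⟨i, hi⟩ := hu
      rw [coeff_pow_char_of_not_dvd p a hi, zero_mul]
  · rintro ⟨u, v⟩ -
    simp only [coeff_pow_char, mul_pow, coeff_cartier_pow]

theorem eq_zero_of_cartier_eq_zero {a : MvPowerSeries σ F}
    (h : ∀ r : σ →₀ ℕ, (∀ i, r i < p) → cartier p r a = 0) :
    a = 0 := by
  have hp : 0 < p := (Fact.out : p.Prime).pos
  ext u
  have hu : u = p • Finsupp.equivFunOnFinite.symm (fun i => u i / p)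
      + Finsupp.equivFunOnFinite.symm (fun i => u i % p) := by
    ext i
    simp [Nat.div_add_mod]
  rw [hu, ← coeff_cartier_pow, h _ (fun i => by simpa using Nat.mod_lt _ hp)]
  simp [hp.ne']

end Cartier

/-! ### Cartier operators in `y` and the residue at `y = f`. -/

section Poly

open Polynomial

variable {σ F : Type*} [Field F] (p : ℕ) [Fact p.Prime] [CharP F p] [PerfectRing F p]

/-- The Cartier operator on polynomials in `y` with coefficients in power series which extracts
the coefficients of `y ^ (p * j + (p - 1))`. -/
noncomputable def polyCartier (r : σ →₀ ℕ) (Q : (MvPowerSeries σ F)[X]) : (MvPowerSeries σ F)[X] :=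
  ∑ j ∈ Finset.range (Q.natDegree + 1),
    Polynomial.monomial j (cartier p r (Q.coeff (p * j + (p - 1))))

theorem coeff_polyCartier (r : σ →₀ ℕ) (Q : (MvPowerSeries σ F)[X]) (j : ℕ) :
    (polyCartier p r Q).coeff j = cartier p r (Q.coeff (p * j + (p - 1))) := by
  have hp : 0 < p := (Fact.out : p.Prime).pos
  simp only [polyCartier, Polynomial.finsetSum_coeff, Polynomial.coeff_monomial,
    Finset.sum_ite_eq', Finset.mem_range]
  split_ifs with h
  · rfl
  · rw [Polynomial.coeff_eq_zero_of_natDegree_lt, map_zero]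
    have : 1 * j ≤ p * j := Nat.mul_le_mul_right _ hp
    omega

theorem polyCartier_add (r : σ →₀ ℕ) (P Q : (MvPowerSeries σ F)[X]) :
    polyCartier p r (P + Q) = polyCartier p r P + polyCartier p r Q := by
  ext1 j
  simp [coeff_polyCartier]

/-- The power `(X - f) ^ (p - 1)` is monic of degree `p - 1`, so only its leading term is extracted.
-/
theorem polyCartier_X_sub_C_pow_pred (r : σ →₀ ℕ) (f a : MvPowerSeries σ F) :
    polyCartier p r ((X - C f) ^ (p - 1) * C a) = C (cartier p r a) := by
  have hp : 0 < p := (Fact.out : p.Prime).pos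
  have hdeg : ((X - C f) ^ (p - 1)).natDegree = p - 1 := by
    rw [natDegree_pow, natDegree_X_sub_C, mul_one]
  ext1 j
  rw [coeff_polyCartier, coeff_mul_C]
  cases j with
  | zero =>
    have : ((X - C f) ^ (p - 1)).coeff (p - 1) = 1 := by
      simpa only [hdeg] using ((monic_X_sub_C f).pow (p - 1)).coeff_natDegree
    rw [mul_zero, zero_add, this, one_mul, coeff_C_zero]
  | succ j =>
    rw [Polynomial.coeff_eq_zero_of_natDegree_lt (by rw [hdeg, mul_add]; omega), zero_mul, map_zero,
      coeff_C_succ]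

variable [Finite σ]

/-- In characteristic `p` the factor is `X ^ p - f ^ p`, and both `p`-th powers come out of the
operator. -/
theorem polyCartier_X_sub_C_pow_mul {r : σ →₀ ℕ} (hr : ∀ i, r i < p) (f : MvPowerSeries σ F)
    (R : (MvPowerSeries σ F)[X]) :
    polyCartier p r ((X - C f) ^ p * R) = (X - C f) * polyCartier p r R := by
  have hp : 0 < p := (Fact.out : p.Prime).pos
  ext1 j
  rw [sub_pow_char, ← C_pow, sub_mul, sub_mul, coeff_polyCartier, coeff_sub, coeff_sub, coeff_C_mul,
    coeff_C_mul, map_sub, cartier_pow_mul p hr, coeff_polyCartier]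
  congr 1
  cases j with
  | zero =>
    rw [Polynomial.coeff_X_pow_mul', if_neg (by omega), map_zero, coeff_X_mul_zero]
  | succ j =>
    rw [coeff_X_mul, coeff_polyCartier, Polynomial.coeff_X_pow_mul', if_pos (by rw [mul_add]; omega)]
    congr 2
    rw [mul_add]
    omega

/-- Evaluation at `f` of the Cartier transform, in place of the residue at `y = f`. -/
theorem eval_polyCartier {r : σ →₀ ℕ} (hr : ∀ i, r i < p) (f : MvPowerSeries σ F)
    (R : (MvPowerSeries σ F)[X]) :
    (polyCartier p r ((X - C f) ^ (p - 1) * R)).eval f = cartier p r (R.eval f) := by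
  have hp : 0 < p := (Fact.out : p.Prime).pos
  -- Writing `R = R(f) + (X - f) R'`, the part with `R'` contributes a multiple of `X - f`, which
  -- vanishes at `f`.
  obtain ⟨R', hR'⟩ := X_sub_C_dvd_sub_C_eval (a := f) (p := R)
  have h : (X - C f) ^ (p - 1) * R
      = (X - C f) ^ p * R' + (X - C f) ^ (p - 1) * C (R.eval f) := by
    rw [← Nat.sub_add_cancel hp, pow_succ, Nat.add_sub_cancel, mul_assoc, ← hR']
    ring
  rw [h, polyCartier_add, polyCartier_X_sub_C_pow_mul p hr, polyCartier_X_sub_C_pow_pred]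
  simp

/-- If `E(f) = 0` and `E'(f) w = P(f)`, then `E'(f) S_r(w) = C_r(P E ^ (p - 1))(f)`. -/
theorem eval_derivative_mul_cartier {r : σ →₀ ℕ} (hr : ∀ i, r i < p) {f w : MvPowerSeries σ F}
    {E P : (MvPowerSeries σ F)[X]} (hE : E.eval f = 0)
    (hw : (derivative E).eval f * w = P.eval f) :
    (derivative E).eval f * cartier p r w = (polyCartier p r (P * E ^ (p - 1))).eval f := by
  have hp : 0 < p := (Fact.out : p.Prime).pos
  -- With `E = (X - f) G` one has `E'(f) = G(f)`, and `G(f) S_r(w) = S_r(G(f)^p w) = S_r(G(f)^(p-1)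
  -- P(f))`.
  obtain ⟨G, rfl⟩ := dvd_iff_isRoot.mpr hE
  have hG : (derivative ((X - C f) * G)).eval f = G.eval f := by simp [derivative_mul]
  rw [hG] at hw ⊢
  rw [mul_pow, mul_left_comm, eval_polyCartier p hr, eval_mul, ← hw, eval_pow,
    ← cartier_pow_mul p hr]
  congr 1
  conv_lhs => rw [← Nat.sub_add_cancel hp, pow_succ]
  ring

end Poly
-- Bounds on exponents, for several weights at once.
section Support

open MvPowerSeries

variable {σ ι R : Type*} [CommRing R]

/-- Every exponent occurring in `a` has weight at most `H i` for the weight `ω i`. -/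
def SupportBounded (ω : ι → (σ →₀ ℕ) →+ ℕ) (H : ι → ℕ) (a : MvPowerSeries σ R) : Prop :=
  ∀ m, coeff m a ≠ 0 → ∀ i, ω i m ≤ H i

variable {ω : ι → (σ →₀ ℕ) →+ ℕ} {H H' : ι → ℕ}

theorem SupportBounded.zero : SupportBounded ω H (0 : MvPowerSeries σ R) :=
  fun _ hm => absurd (map_zero _) hm

theorem SupportBounded.add {a b : MvPowerSeries σ R} (ha : SupportBounded ω H a)
    (hb : SupportBounded ω H b) : SupportBounded ω H (a + b) := fun m hm => by
  by_cases h : coeff m a = 0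
  · exact hb m fun h' => hm (by rw [map_add, h, h', add_zero])
  · exact ha m h

theorem SupportBounded.sum {κ : Type*} {s : Finset κ} {a : κ → MvPowerSeries σ R}
    (ha : ∀ x ∈ s, SupportBounded ω H (a x)) : SupportBounded ω H (∑ x ∈ s, a x) :=
  Finset.sum_induction _ _ (fun _ _ => SupportBounded.add) SupportBounded.zero ha

theorem SupportBounded.mul {a b : MvPowerSeries σ R} (ha : SupportBounded ω H a)
    (hb : SupportBounded ω H' b) : SupportBounded ω (H + H') (a * b) := fun m hm i => by
  classical
  rw [coeff_mul] at hm
  obtain ⟨x, hx, hne⟩ := Finset.exists_ne_zero_of_sum_ne_zero hm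
  rw [Finset.HasAntidiagonal.mem_antidiagonal] at hx
  rw [← hx, map_add]
  exact add_le_add (ha _ (left_ne_zero_of_mul hne) i) (hb _ (right_ne_zero_of_mul hne) i)

theorem SupportBounded.one : SupportBounded ω 0 (1 : MvPowerSeries σ R) := fun m hm i => by
  classical
  rw [coeff_one] at hm
  rw [(ite_ne_right_iff.mp hm).1, map_zero, Pi.zero_apply]

theorem SupportBounded.mul_natCast {a : MvPowerSeries σ R} (ha : SupportBounded ω H a) (k : ℕ) :
    SupportBounded ω H (a * (k : MvPowerSeries σ R)) := fun m hm => ha m fun h => hm (by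
  rw [← nsmul_eq_mul', map_nsmul, h, nsmul_zero])

theorem SupportBounded.poly_mul {P Q : Polynomial (MvPowerSeries σ R)}
    (hP : ∀ j, SupportBounded ω H (P.coeff j)) (hQ : ∀ j, SupportBounded ω H' (Q.coeff j)) (j : ℕ) :
    SupportBounded ω (H + H') ((P * Q).coeff j) := by
  rw [Polynomial.coeff_mul]
  exact SupportBounded.sum fun x _ => (hP _).mul (hQ _)

theorem SupportBounded.poly_pow {P : Polynomial (MvPowerSeries σ R)}
    (hP : ∀ j, SupportBounded ω H (P.coeff j)) (k j : ℕ) :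
    SupportBounded ω (k • H) ((P ^ k).coeff j) := by
  induction k generalizing j with
  | zero =>
    rw [pow_zero, zero_smul, Polynomial.coeff_one]
    split_ifs
    · exact SupportBounded.one
    · exact SupportBounded.zero
  | succ k ih =>
    rw [pow_succ, succ_nsmul]
    exact SupportBounded.poly_mul ih hP j

theorem SupportBounded.poly_derivative {P : Polynomial (MvPowerSeries σ R)}
    (hP : ∀ j, SupportBounded ω H (P.coeff j)) (j : ℕ) :
    SupportBounded ω H (P.derivative.coeff j) := by
  rw [Polynomial.coeff_derivative]
  exact_mod_cast (hP (j + 1)).mul_natCast (j + 1)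

theorem SupportBounded.poly_X_mul {P : Polynomial (MvPowerSeries σ R)}
    (hP : ∀ j, SupportBounded ω H (P.coeff j)) (j : ℕ) :
    SupportBounded ω H ((Polynomial.X * P).coeff j) := by
  cases j with
  | zero => rw [Polynomial.coeff_X_mul_zero]; exact SupportBounded.zero
  | succ j => rw [Polynomial.coeff_X_mul]; exact hP j

end Support

/-! ### Separable equations and the Cartier-stable set of residues. -/

section Equation

open Polynomial

variable {σ ι F : Type*} [Field F] {ω : ι → (σ →₀ ℕ) →+ ℕ} {H : ι → ℕ}

theorem SupportBounded.mono {H' : ι → ℕ} {a : MvPowerSeries σ F} (ha : SupportBounded ω H a)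
    (h : H ≤ H') : SupportBounded ω H' a := fun m hm i => (ha m hm i).trans (h i)

/-- The power series of the form `P(f) / E'(f)`, with `P` of degree at most `d` in `y` and with
bounded exponents. -/
def residueSpace (ω : ι → (σ →₀ ℕ) →+ ℕ) (H : ι → ℕ) (d : ℕ) (E : (MvPowerSeries σ F)[X])
    (f : MvPowerSeries σ F) : Set (MvPowerSeries σ F) :=
  {w | ∃ P : (MvPowerSeries σ F)[X], P.natDegree ≤ d ∧ (∀ j, SupportBounded ω H (P.coeff j)) ∧
    (derivative E).eval f * w = P.eval f}

variable {d : ℕ} {E : (MvPowerSeries σ F)[X]} {f : MvPowerSeries σ F}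

theorem self_mem_residueSpace (hd : E.natDegree ≤ d) (hE : ∀ j, SupportBounded ω H (E.coeff j)) :
    f ∈ residueSpace ω H d E f := by
  -- The numerator `y E'` represents `f = f E'(f) / E'(f)` and has degree at most `d`.
  refine ⟨X * derivative E, ?_, SupportBounded.poly_X_mul (SupportBounded.poly_derivative hE), ?_⟩
  · rcases Nat.eq_zero_or_pos E.natDegree with h | h
    · rw [eq_C_of_natDegree_eq_zero h]
      simp
    · have := natDegree_derivative_lt h.ne'
      exact natDegree_mul_le.trans (by rw [natDegree_X]; omega)
  · rw [eval_mul, eval_X, mul_comm]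

variable (p : ℕ) [Fact p.Prime] [CharP F p] [PerfectRing F p]

/-- Weights are additive and nonnegative: `p ω(m) ≤ ω(p m + r) ≤ p H`. -/
theorem SupportBounded.cartier {a : MvPowerSeries σ F} (ha : SupportBounded ω (p • H) a)
    (r : σ →₀ ℕ) : SupportBounded ω H (cartier p r a) := fun m hm i => by
  have hp : 0 < p := (Fact.out : p.Prime).pos
  have h := ha (p • m + r) (by rw [← coeff_cartier_pow]; exact pow_ne_zero _ hm) i
  rw [map_add, map_nsmul, Pi.smul_apply, smul_eq_mul, smul_eq_mul] at h
  exact Nat.le_of_mul_le_mul_left (le_of_add_le_left h) hp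

variable [Finite σ]

/-- Over a perfect field of characteristic `p`, a power series which is a root of a polynomial with
bounded coefficients is a simple root of another one. -/
theorem exists_eval_derivative_ne_zero (p : ℕ) [Fact p.Prime] [CharP F p] [PerfectRing F p]
    (h : ∃ E : (MvPowerSeries σ F)[X], E ≠ 0 ∧ E.natDegree ≤ d ∧
      (∀ j, SupportBounded ω H (E.coeff j)) ∧ E.eval f = 0) :
    ∃ E : (MvPowerSeries σ F)[X], E.natDegree ≤ d ∧ (∀ j, SupportBounded ω H (E.coeff j)) ∧
      E.eval f = 0 ∧ (derivative E).eval f ≠ 0 := by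
  have hp : 1 < p := (Fact.out : p.Prime).one_lt
  let s : Set (MvPowerSeries σ F)[X] := {E | E ≠ 0 ∧ E.natDegree ≤ d ∧
    (∀ j, SupportBounded ω H (E.coeff j)) ∧ E.eval f = 0}
  obtain ⟨E, ⟨hE0, hEd, hEb, hEf⟩, hmin⟩ :=
    WellFounded.has_min (measure (natDegree : (MvPowerSeries σ F)[X] → ℕ)).wf s h
  refine ⟨E, hEd, hEb, hEf, fun hder => ?_⟩
  have hlt : ∀ Q : (MvPowerSeries σ F)[X], Q.natDegree < E.natDegree →
      (∀ j, SupportBounded ω H (Q.coeff j)) → Q.eval f = 0 → Q = 0 := fun Q hQ hQb hQf => by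
    by_contra hQ0
    exact hmin Q ⟨hQ0, hQ.le.trans hEd, hQb, hQf⟩ hQ
  have hpos : 0 < E.natDegree := by
    by_contra h0
    rw [eq_C_of_natDegree_eq_zero (Nat.eq_zero_of_not_pos h0), eval_C] at hEf
    rw [eq_C_of_natDegree_eq_zero (Nat.eq_zero_of_not_pos h0), hEf, C_0] at hE0
    exact hE0 rfl
  have hder0 : derivative E = 0 :=
    hlt _ (natDegree_derivative_lt hpos.ne') (SupportBounded.poly_derivative hEb) hder
  -- Now `E = Q(y^p)`. Applying `S_r` to `Q(f^p) = 0` gives equations of `f` of smaller degree with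
  -- bounded exponents; by minimality they all vanish, which forces `Q = 0`.
  have hexp := expand_contract p hder0 (by omega)
  set Q := contract p E with hQ
  have hdeg : Q.natDegree < E.natDegree := by
    have := natDegree_expand p Q
    rw [hexp] at this
    rcases Nat.eq_zero_or_pos Q.natDegree with h0 | h0
    · omega
    · rw [this]
      exact lt_mul_of_one_lt_right h0 hp
  have hsection : ∀ r : σ →₀ ℕ, (∀ i, r i < p) → ∀ j, cartier p r (Q.coeff j) = 0 := by
    intro r hr
    let Er : (MvPowerSeries σ F)[X] :=
      ∑ j ∈ Finset.range (Q.natDegree + 1), monomial j (cartier p r (Q.coeff j))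
    have hcoeff : ∀ j, Er.coeff j = cartier p r (Q.coeff j) := fun j => by
      simp only [Er, finsetSum_coeff, coeff_monomial, Finset.sum_ite_eq', Finset.mem_range]
      split_ifs with hj
      · rfl
      · rw [coeff_eq_zero_of_natDegree_lt (by omega), map_zero]
    have hEr : Er = 0 := by
      refine hlt _ (lt_of_le_of_lt (natDegree_sum_le_of_forall_le _ _ fun j hj => ?_) hdeg) ?_ ?_
      · exact (natDegree_monomial_le _).trans (Nat.lt_succ_iff.mp (Finset.mem_range.mp hj))
      · intro j
        rw [hcoeff, hQ, coeff_contract (by omega)]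
        refine SupportBounded.cartier p (SupportBounded.mono (hEb _) fun i => ?_) r
        exact Nat.le_mul_of_pos_left _ (by omega)
      · have h1 : Q.eval (f ^ p) = 0 := by rw [← expand_eval, hexp, hEf]
        have h2 : cartier p r (Q.eval (f ^ p)) = Er.eval f := by
          rw [eval_eq_sum_range, map_sum, eval_finsetSum]
          refine Finset.sum_congr rfl fun j _ => ?_
          rw [eval_monomial, ← pow_mul, mul_comm p, pow_mul, mul_comm, cartier_pow_mul p hr,
            mul_comm]
        rw [← h2, h1, map_zero]
    intro j
    rw [← hcoeff, hEr, coeff_zero]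
  refine hE0 ?_
  rw [← hexp]
  have : Q = 0 := by
    ext1 j
    rw [coeff_zero]
    exact eq_zero_of_cartier_eq_zero p fun r hr => hsection r hr j
  rw [this, map_zero]

/-- The product `P E^(p-1)` has degree at most `p d` and weights at most `p H`; the Cartier operator
restores the bounds `d` and `H`. -/
theorem cartier_mem_residueSpace (hd : E.natDegree ≤ d)
    (hE : ∀ j, SupportBounded ω H (E.coeff j)) (hEf : E.eval f = 0) {r : σ →₀ ℕ}
    (hr : ∀ i, r i < p) {w : MvPowerSeries σ F} (hw : w ∈ residueSpace ω H d E f) :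
    cartier p r w ∈ residueSpace ω H d E f := by
  have hp : 1 < p := (Fact.out : p.Prime).one_lt
  obtain ⟨P, hPd, hPb, hPw⟩ := hw
  refine ⟨_, ?_, ?_, eval_derivative_mul_cartier p hr hEf hPw⟩
  · rw [natDegree_le_iff_coeff_eq_zero]
    intro j hj
    rw [coeff_polyCartier, coeff_eq_zero_of_natDegree_lt, map_zero]
    calc (P * E ^ (p - 1)).natDegree ≤ d + (p - 1) * d :=
          natDegree_mul_le_of_le hPd (natDegree_pow_le_of_le _ hd)
      _ = p * d := by
          obtain ⟨q, rfl⟩ := Nat.exists_eq_add_of_lt hp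
          rw [Nat.add_sub_cancel]; ring
      _ < p * j := Nat.mul_lt_mul_of_pos_left hj (by omega)
      _ ≤ p * j + (p - 1) := Nat.le_add_right _ _
  · intro j
    rw [coeff_polyCartier]
    refine SupportBounded.cartier p (SupportBounded.mono
      (SupportBounded.poly_mul hPb (SupportBounded.poly_pow hE (p - 1)) _) (le_of_eq ?_)) r
    rw [← succ_nsmul', Nat.sub_add_cancel hp.le]

end Equation
-- Diagonals, as modules over `F[t₁⋯tₙ]` and under Cartier operators.
section Diagonal

open Polynomial

variable {n : ℕ} {F : Type*} [Field F]

/-- The exponent `(i, …, i)`. -/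
noncomputable def constExponent (n i : ℕ) : Fin n →₀ ℕ :=
  Finsupp.equivFunOnFinite.symm fun _ => i

@[simp]
theorem constExponent_apply (i : ℕ) (j : Fin n) : constExponent n i j = i := rfl

theorem coeff_diagonal {R : Type*} [CommRing R] (f : MvPowerSeries (Fin n) R) (i : ℕ) :
    (diagonal f).coeff i = f.coeff (constExponent n i) := by
  rw [diagonal, PowerSeries.coeff_mk, constExponent]

theorem diagonal_add (a b : MvPowerSeries (Fin n) F) :
    diagonal (a + b) = diagonal a + diagonal b := by
  ext i; simp [coeff_diagonal]

theorem diagonal_zero : diagonal (0 : MvPowerSeries (Fin n) F) = 0 := by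
  ext i; simp [coeff_diagonal]

theorem diagonal_sum {κ : Type*} (s : Finset κ) (a : κ → MvPowerSeries (Fin n) F) :
    diagonal (∑ x ∈ s, a x) = ∑ x ∈ s, diagonal (a x) := by
  ext i; simp [coeff_diagonal]

/-- The product `t₁ ⋯ tₙ`. -/
noncomputable def allVars (n : ℕ) (F : Type*) [Field F] : MvPowerSeries (Fin n) F :=
  MvPowerSeries.monomial (constExponent n 1) 1

theorem allVars_pow (k : ℕ) :
    allVars n F ^ k = MvPowerSeries.monomial (k • constExponent n 1) 1 := by
  rw [allVars, MvPowerSeries.monomial_pow, one_pow]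

theorem diagonal_allVars_mul (hn : 1 ≤ n) (a : MvPowerSeries (Fin n) F) :
    diagonal (allVars n F * a) = PowerSeries.X * diagonal a := by
  ext i
  rw [coeff_diagonal, allVars]
  cases i with
  | zero =>
    rw [MvPowerSeries.coeff_monomial_mul, if_neg, PowerSeries.coeff_zero_X_mul]
    intro h
    have := h ⟨0, hn⟩
    simp at this
  | succ i =>
    have : constExponent n (i + 1) = constExponent n 1 + constExponent n i := by
      ext j; simp [add_comm]
    rw [this, MvPowerSeries.coeff_add_monomial_mul, one_mul, PowerSeries.coeff_succ_X_mul,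
      coeff_diagonal]

theorem diagonal_aeval_mul (hn : 1 ≤ n) (c : F[X]) (a : MvPowerSeries (Fin n) F) :
    diagonal (aeval (allVars n F) c * a) = (c : PowerSeries F) * diagonal a := by
  induction c using Polynomial.induction_on generalizing a with
  | C x =>
    ext i
    rw [aeval_C, MvPowerSeries.algebraMap_apply, coeff_diagonal, Polynomial.coe_C,
      PowerSeries.coeff_C_mul, Algebra.algebraMap_self_apply, MvPowerSeries.coeff_C_mul,
      coeff_diagonal]
  | add p q hp hq => rw [map_add, add_mul, diagonal_add, hp, hq, Polynomial.coe_add, add_mul]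
  | monomial k x ih =>
    rw [pow_succ, ← mul_assoc, map_mul, aeval_X, mul_assoc, ih, diagonal_allVars_mul hn,
      Polynomial.coe_mul (_ * _), Polynomial.coe_X, mul_assoc]

/-- The diagonal exponents congruent to `r` modulo `p` are `p • (q, …, q) + (r, …, r)`. -/
theorem diagonal_eq_sum_cartier (p : ℕ) [Fact p.Prime] [CharP F p] [PerfectRing F p]
    (a : MvPowerSeries (Fin n) F) :
    diagonal a = ∑ r ∈ Finset.range p,
      PowerSeries.X ^ r * diagonal (cartier p (constExponent n r) a) ^ p := by
  have hp : 0 < p := (Fact.out : p.Prime).pos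
  -- Univariate series are multivariate series indexed by `Unit`.
  have hpow (g : PowerSeries F) (q : ℕ) : (g ^ p).coeff (p * q) = g.coeff q ^ p := by
    have := coeff_pow_char (σ := Unit) p g (Finsupp.single () q)
    rwa [Finsupp.smul_single, smul_eq_mul] at this
  have hpow' (g : PowerSeries F) (q : ℕ) (hq : ¬ p ∣ q) : (g ^ p).coeff q = 0 :=
    coeff_pow_char_of_not_dvd (σ := Unit) p g (m := Finsupp.single () q) (i := ()) (by simpa)
  ext N
  rw [map_sum, Finset.sum_eq_single (N % p)]
  · rw [PowerSeries.coeff_X_pow_mul', if_pos (Nat.mod_le _ _)]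
    have h : N - N % p = p * (N / p) := by
      have := Nat.div_add_mod N p
      omega
    rw [h, hpow, coeff_diagonal, coeff_diagonal, coeff_cartier_pow]
    congr 2
    ext j
    simp [Nat.div_add_mod]
  · intro r hr hne
    rw [PowerSeries.coeff_X_pow_mul']
    split_ifs with hle
    · refine hpow' _ _ fun hdvd => hne ?_
      rw [← Nat.mod_eq_of_lt (Finset.mem_range.mp hr)]
      exact ((Nat.modEq_iff_dvd' hle).mpr hdvd)
    · rfl
  · intro h
    exact absurd (Finset.mem_range.mpr (Nat.mod_lt _ hp)) h

end Diagonal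

/-! ### Bounding the rank of the residues and of their diagonals. -/

section Dependence

open Polynomial

open scoped RatFunc

variable {n : ℕ} {F ι : Type*} [Field F] {ω : ι → (Fin n →₀ ℕ) →+ ℕ} {H : ι → ℕ}

/-- The combinations of a finite family of power series with coefficients in `F[t₁ ⋯ tₙ]`. -/
noncomputable def combination {κ : Type*} [Fintype κ] (v : κ → MvPowerSeries (Fin n) F) :
    (κ → F[X]) →+ MvPowerSeries (Fin n) F where
  toFun c := ∑ k, aeval (allVars n F) (c k) * v k
  map_zero' := by simp
  map_add' c c' := by simp [add_mul, Finset.sum_add_distrib]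

theorem combination_apply {κ : Type*} [Fintype κ] (v : κ → MvPowerSeries (Fin n) F)
    (c : κ → F[X]) : combination v c = ∑ k, aeval (allVars n F) (c k) * v k := rfl

/-- Each allowed monomial is `t^b (t₁⋯tₙ)^k` with `b ∈ B₀`, so finitely many generators suffice over
`F[t₁⋯tₙ]`. -/
theorem eval_mem_range_combination {B₀ : Finset (Fin n →₀ ℕ)}
    (hfin : {m | ∀ i, ω i m ≤ H i}.Finite)
    (hB₀ : ∀ m, (∀ i, ω i m ≤ H i) → ∃ b ∈ B₀, ∃ k : ℕ, m = b + k • constExponent n 1)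
    {d : ℕ} {P : (MvPowerSeries (Fin n) F)[X]} (hd : P.natDegree ≤ d)
    (hP : ∀ j, SupportBounded ω H (P.coeff j)) (f : MvPowerSeries (Fin n) F) :
    P.eval f ∈ (combination fun x : Fin (d + 1) × B₀ =>
      MvPowerSeries.monomial x.2.1 1 * f ^ (x.1 : ℕ)).range := by
  classical
  rw [eval_eq_sum_range' (Nat.lt_succ_of_le hd)]
  refine sum_mem fun j hj => ?_
  have hcoeff : P.coeff j = ∑ m ∈ hfin.toFinset, MvPowerSeries.monomial m ((P.coeff j).coeff m) := by
    ext m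
    simp only [map_sum, MvPowerSeries.coeff_monomial, Finset.sum_ite_eq, Set.Finite.mem_toFinset,
      Set.mem_ofPred_eq]
    split_ifs with h
    · rfl
    · by_contra h0
      exact h (hP j m h0)
  rw [hcoeff, Finset.sum_mul]
  refine sum_mem fun m hm => ?_
  obtain ⟨b, hb, k, rfl⟩ := hB₀ m (by simpa using hm)
  refine ⟨Pi.single (⟨j, Finset.mem_range.mp hj⟩, ⟨b, hb⟩)
    (Polynomial.monomial k ((P.coeff j).coeff (b + k • constExponent n 1))), ?_⟩
  rw [combination_apply, Finset.sum_eq_single (⟨j, Finset.mem_range.mp hj⟩, ⟨b, hb⟩)]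
  · rw [Pi.single_eq_same, aeval_monomial, allVars_pow, MvPowerSeries.algebraMap_apply,
      Algebra.algebraMap_self_apply, ← MvPowerSeries.monomial_zero_eq_C_apply, ← mul_assoc,
      MvPowerSeries.monomial_mul_monomial, MvPowerSeries.monomial_mul_monomial]
    simp [add_comm]
  · intro x _ hx
    rw [Pi.single_eq_of_ne hx, map_zero, zero_mul]
  · intro h
    exact absurd (Finset.mem_univ _) h

theorem exists_dependence_residueSpace {B₀ : Finset (Fin n →₀ ℕ)}
    (hfin : {m | ∀ i, ω i m ≤ H i}.Finite)
    (hB₀ : ∀ m, (∀ i, ω i m ≤ H i) → ∃ b ∈ B₀, ∃ k : ℕ, m = b + k • constExponent n 1)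
    {d : ℕ} {E : (MvPowerSeries (Fin n) F)[X]} {f : MvPowerSeries (Fin n) F}
    (hder : (derivative E).eval f ≠ 0) {κ : Type*} [Fintype κ]
    (hκ : (d + 1) * B₀.card < Fintype.card κ) {w : κ → MvPowerSeries (Fin n) F}
    (hw : ∀ k, w k ∈ residueSpace ω H d E f) :
    ∃ c : κ → F[X], c ≠ 0 ∧ combination w c = 0 := by
  choose P hPd hPb hPw using hw
  choose M hM using fun k => eval_mem_range_combination hfin hB₀ (hPd k) (hPb k) f
  -- The numerators give a matrix over `F[X]` with more rows than columns, so its rows are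
  -- dependent; the factor `E'(f) ≠ 0` is cancelled afterwards.
  have hninj : ¬ Function.Injective (Matrix.vecMulLinear (Matrix.of M)) := fun hinj => by
    have := card_le_of_injective F[X] _ hinj
    rw [Fintype.card_prod, Fintype.card_fin, Fintype.card_coe] at this
    omega
  rw [← LinearMap.ker_eq_bot, Submodule.eq_bot_iff] at hninj
  push Not at hninj
  obtain ⟨c, hc, hc0⟩ := hninj
  refine ⟨c, hc0, (mul_eq_zero.mp ?_).resolve_left hder⟩
  have hc' (x) : ∑ k, c k * M k x = 0 := congrFun hc x
  rw [combination_apply, Finset.mul_sum]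
  calc ∑ k, (derivative E).eval f * (aeval (allVars n F) (c k) * w k)
      = ∑ k, ∑ x : Fin (d + 1) × B₀, aeval (allVars n F) (c k * M k x) *
          (MvPowerSeries.monomial x.2.1 1 * f ^ (x.1 : ℕ)) := by
        refine Finset.sum_congr rfl fun k _ => ?_
        rw [mul_left_comm, hPw, ← hM, combination_apply, Finset.mul_sum]
        exact Finset.sum_congr rfl fun x _ => by rw [map_mul, mul_assoc]
    _ = 0 := by
        rw [Finset.sum_comm]
        refine Finset.sum_eq_zero fun x _ => ?_
        rw [← Finset.sum_mul, ← map_sum, hc', map_zero, zero_mul]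

theorem toLaurent_polynomial_mul (c : F[X]) (g : PowerSeries F) :
    toLaurent ((c : PowerSeries F) * g) = algebraMap F[X] (RatFunc F) c • toLaurent g := by
  rw [toLaurent, map_mul, Algebra.smul_def]
  congr 1
  exact RatFunc.coe_coe c

theorem not_linearIndependent_toLaurent_diagonal (hn : 1 ≤ n) {κ : Type*} [Fintype κ]
    {w : κ → MvPowerSeries (Fin n) F} (h : ∃ c : κ → F[X], c ≠ 0 ∧ combination w c = 0) :
    ¬ LinearIndependent (RatFunc F) fun k => toLaurent (diagonal (w k)) := by
  obtain ⟨c, hc0, hc⟩ := h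
  rw [Fintype.not_linearIndependent_iff]
  obtain ⟨k, hk⟩ := Function.ne_iff.mp hc0
  refine ⟨fun k => algebraMap F[X] (RatFunc F) (c k), ?_, k, ?_⟩
  · simp_rw [← toLaurent_polynomial_mul, ← diagonal_aeval_mul hn, toLaurent, ← map_sum,
      ← diagonal_sum]
    rw [← combination_apply, hc, diagonal_zero, map_zero]
  · simpa using hk

end Dependence

/-! ### Linear algebra with the semilinear Frobenius map. -/

section Frobenius

variable {K V : Type*} [Field K] [CommRing V] [Algebra K V] (p : ℕ) [Fact p.Prime] [CharP V p]

theorem pow_mem_span_pow {s : Set V} {x : V} (hx : x ∈ Submodule.span K s) :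
    x ^ p ∈ Submodule.span K ((fun y => y ^ p) '' s) := by
  induction hx using Submodule.span_induction with
  | mem x h => exact Submodule.subset_span ⟨x, h, rfl⟩
  | zero => rw [zero_pow (NeZero.ne p)]; exact zero_mem _
  | add x y _ _ hx hy => rw [add_pow_char]; exact add_mem hx hy
  | smul a x _ hx => rw [smul_pow]; exact Submodule.smul_mem _ _ hx

theorem pow_iterate_mem_span_pow {s : Set V} {x : V} (hx : x ∈ Submodule.span K s) (k : ℕ) :
    x ^ p ^ k ∈ Submodule.span K ((fun y => y ^ p ^ k) '' s) := by
  induction k with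
  | zero => simpa using hx
  | succ k ih =>
    have := pow_mem_span_pow p ih
    rw [Set.image_image] at this
    simpa only [pow_succ, pow_mul] using this

/-- A set contained in the span of the `p`-th powers of its elements and whose independent finite
subfamilies have at most `D` elements: each of its elements is killed by a linearized polynomial
of `p`-degree at most `D`. -/
theorem exists_sum_smul_pow_eq_zero {s : Set V} {D : ℕ}
    (hs : ∀ x ∈ s, x ∈ Submodule.span K ((fun y => y ^ p) '' s))
    (hD : ∀ v : Fin (D + 1) → V, (∀ i, v i ∈ s) → ¬ LinearIndependent K v) {g : V} (hg : g ∈ s) :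
    ∃ m ≤ D, ∃ c : Fin (m + 1) → K, c ≠ 0 ∧ ∑ i, c i • g ^ p ^ (i : ℕ) = 0 := by
  classical
  have hex : ∃ m, ∀ v : Fin m → V, (∀ i, v i ∈ s) → ¬ LinearIndependent K v := ⟨_, hD⟩
  -- Here `m + 1` is the least size at which no independent family in `s` exists, so some
  -- independent family of size `m` spans `s`.
  obtain ⟨m, hm⟩ : ∃ m, Nat.find hex = m + 1 := by
    refine Nat.exists_eq_succ_of_ne_zero fun h0 => ?_
    have := Nat.find_spec hex
    rw [h0] at this
    exact this Fin.elim0 (fun i => i.elim0) linearIndependent_empty_type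
  have hmD : m ≤ D := by
    have := Nat.find_min' hex hD
    omega
  have hlt := Nat.find_min hex (m := m) (by omega)
  push Not at hlt
  obtain ⟨v, hvs, hv⟩ := hlt
  have hspan : ∀ x ∈ s, x ∈ Submodule.span K (Set.range v) := fun x hx => by
    by_contra hnot
    have hmax := Nat.find_spec hex
    rw [hm] at hmax
    refine hmax (Fin.snoc v x) (fun i => ?_) (linearIndependent_finSnoc.mpr ⟨hv, hnot⟩)
    induction i using Fin.lastCases with
    | last => simpa using hx
    | cast i => simpa using hvs i
  have hpow : ∀ k, ∀ x ∈ s, x ∈ Submodule.span K ((fun y => y ^ p ^ k) '' Set.range v) := by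
    intro k
    induction k with
    | zero => simpa using hspan
    | succ k ih =>
      intro x hx
      refine Submodule.span_le.mpr ?_ (hs x hx)
      rintro _ ⟨y, hy, rfl⟩
      have := pow_mem_span_pow p (ih y hy)
      rw [Set.image_image] at this
      simpa only [pow_succ, pow_mul, SetLike.mem_coe] using this
  refine ⟨m, hmD, ?_⟩
  have hdep : ¬ LinearIndependent K fun i : Fin (m + 1) => g ^ p ^ (i : ℕ) := fun hli => by
    have hle : Set.range (fun i : Fin (m + 1) => g ^ p ^ (i : ℕ)) ≤
        Submodule.span K (Set.range fun i : Fin m => v i ^ p ^ m) := by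
      rintro _ ⟨i, rfl⟩
      -- Expanding `g` on the powers of exponent `p ^ (m - i)` and then raising to the power `p ^ i`
      -- gives the same `m` vectors for every `i`.
      have := pow_iterate_mem_span_pow p (hpow (m - i) g hg) i
      rw [Set.image_image, ← Set.range_comp] at this
      have hexp (y : V) : (y ^ p ^ m) = (y ^ p ^ (m - (i : ℕ))) ^ p ^ (i : ℕ) := by
        rw [← pow_mul, ← pow_add, Nat.sub_add_cancel (Nat.lt_succ_iff.mp i.2)]
      simp only [hexp]
      exact this
    have h1 := linearIndependent_le_span' _ hli _ hle
    have h2 := Fintype.card_le_of_surjective _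
      (Set.rangeFactorization_surjective (f := fun i : Fin m => v i ^ p ^ m))
    rw [Cardinal.mk_fin, Nat.cast_le] at h1
    rw [Fintype.card_fin] at h2
    omega
  rw [Fintype.not_linearIndependent_iff] at hdep
  obtain ⟨c, hc, i, hi⟩ := hdep
  exact ⟨c, fun h => hi (congrFun h i), hc⟩

end Frobenius
-- Reduction of an algebraic equation, and finiteness of residue fields.
section Reduction

/-- Without a relation over `F`, the reduced rows span `J → F` and some square minor is nonzero in
`F`. That minor is then nonzero in `Z`, hence in `k` by injectivity, which excludes a relation over
`k`. -/
theorem exists_linear_relation_map {Z k F J U : Type*} [CommRing Z] [Field k] [Field F]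
    [Fintype J] {φ : Z →+* k} (hφ : Function.Injective φ) (π : Z →+* F) (z : U → J → Z)
    (h : ∃ e : J → k, e ≠ 0 ∧ ∀ u, ∑ j, φ (z u j) * e j = 0) :
    ∃ e : J → F, e ≠ 0 ∧ ∀ u, ∑ j, π (z u j) * e j = 0 := by
  classical
  by_contra hcon
  push Not at hcon
  obtain ⟨e, he0, he⟩ := h
  let rows : Set (J → F) := Set.range fun u j => π (z u j)
  have hspan : Submodule.span F rows = ⊤ := by
    by_contra hne
    obtain ⟨ℓ, hℓ0, hℓ⟩ := Submodule.exists_le_ker_of_lt_top _ (lt_top_iff_ne_top.mpr hne)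
    have hℓ' : ∀ x, ∑ j, x j * ℓ (Pi.single j 1) = ℓ x := fun x => by
      conv_rhs => rw [pi_eq_sum_univ' x, map_sum]
      refine Finset.sum_congr rfl fun j _ => ?_
      rw [map_smul, smul_eq_mul]
    have hne0 : (fun j => ℓ (Pi.single j 1)) ≠ 0 := fun h0 => hℓ0 (LinearMap.ext fun x => by
      rw [← hℓ']
      exact Finset.sum_eq_zero fun j _ => by rw [show ℓ (Pi.single j 1) = 0 from congrFun h0 j,
        mul_zero])
    obtain ⟨u, hu⟩ := hcon _ hne0
    exact hu ((hℓ' _).trans (hℓ (Submodule.subset_span ⟨u, rfl⟩)))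
  obtain ⟨b, hb, hbspan, hbli⟩ := exists_linearIndependent F rows
  let B : Module.Basis b F (J → F) := Module.Basis.mk hbli (by
    rw [Subtype.range_coe, hbspan, hspan])
  let σ : J ≃ b := (Pi.basisFun F J).indexEquiv B
  choose u hu using fun j => hb (σ j).2
  let M : Matrix J J Z := Matrix.of fun i j => z (u i) j
  have hunit : IsUnit (M.map π) := by
    rw [← Matrix.linearIndependent_rows_iff_isUnit]
    have : (M.map π).row = (Subtype.val : b → J → F) ∘ σ := funext fun i => hu i
    rw [this]
    exact hbli.comp σ σ.injective
  have hdet : M.det ≠ 0 := fun h0 => by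
    rw [Matrix.isUnit_iff_isUnit_det, ← RingHom.mapMatrix_apply, ← RingHom.map_det, h0,
      map_zero] at hunit
    exact not_isUnit_zero hunit
  refine he0 (Matrix.eq_zero_of_mulVec_eq_zero (M := M.map φ) ?_ (funext fun i => he (u i)))
  rw [← RingHom.mapMatrix_apply, ← RingHom.map_det]
  exact (map_ne_zero_iff φ hφ).mpr hdet

theorem map_coeff_monomial_mul {Z L σ : Type*} [CommRing Z] [CommRing L] (ψ : Z →+* L)
    (u m : σ →₀ ℕ) (g : MvPowerSeries σ Z) (a : L) :
    ψ ((MvPowerSeries.monomial m 1 * g).coeff u) * a =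
      (MvPowerSeries.monomial m a * MvPowerSeries.map ψ g).coeff u := by
  classical
  simp only [MvPowerSeries.coeff_monomial_mul, MvPowerSeries.coeff_map]
  split_ifs
  · rw [one_mul, mul_comm]
  · rw [map_zero, zero_mul]

/-- An algebraic equation over `k` of a power series with coefficients in the subring `Z` can be
turned into a nonzero equation of its reduction, with no new monomials. -/
theorem exists_reduced_equation {Z k F σ : Type*} [CommRing Z] [Field k] [Field F]
    {φ : Z →+* k} (hφ : Function.Injective φ) (π : Z →+* F) (f : MvPowerSeries σ Z)
    {E : Polynomial (MvPolynomial σ k)} (hE0 : E ≠ 0)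
    (hE : Polynomial.aeval (MvPowerSeries.map φ f) E = 0) {B : Finset (σ →₀ ℕ)}
    (hB : ∀ j, (E.coeff j).support ⊆ B) :
    ∃ Q : Polynomial (MvPowerSeries σ F), Q ≠ 0 ∧ Q.natDegree ≤ E.natDegree ∧
      (∀ j m, (Q.coeff j).coeff m ≠ 0 → m ∈ B) ∧ Q.eval (MvPowerSeries.map π f) = 0 := by
  classical
  let d := E.natDegree
  obtain ⟨e, he0, he⟩ := exists_linear_relation_map hφ π
    -- The unknowns are the coefficients of the equation; there is one linear condition for each
    -- exponent `u`, with entries in `Z`.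
    (fun (u : σ →₀ ℕ) (x : Fin (d + 1) × B) =>
      (MvPowerSeries.monomial x.2.1 1 * f ^ (x.1 : ℕ)).coeff u) (by
    refine ⟨fun x => (E.coeff x.1).coeff x.2.1, fun h0 => hE0 ?_, fun u => ?_⟩
    · ext j m
      rw [Polynomial.coeff_zero, MvPolynomial.coeff_zero]
      by_cases hj : d < j
      · rw [Polynomial.coeff_eq_zero_of_natDegree_lt hj, MvPolynomial.coeff_zero]
      by_cases hm : m ∈ B
      · exact congrFun h0 (⟨j, by omega⟩, ⟨m, hm⟩)
      · by_contra hne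
        exact hm (hB j (MvPolynomial.mem_support_iff.mpr hne))
    · have h := congrArg (MvPowerSeries.coeff u) hE
      rw [Polynomial.aeval_eq_sum_range, map_zero, map_sum] at h
      rw [← h, Fintype.sum_prod_type, Finset.sum_range]
      refine Finset.sum_congr rfl fun j _ => ?_
      have hcoe : algebraMap (MvPolynomial σ k) (MvPowerSeries σ k) (E.coeff j) =
          ∑ m : B, MvPowerSeries.monomial m.1 ((E.coeff j).coeff m.1) := by
        ext m
        simp only [MvPowerSeries.algebraMap_apply', map_sum, MvPowerSeries.coeff_monomial]
        rw [Finset.sum_coe_sort B fun x => if m = x then (E.coeff j).coeff x else 0,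
          Finset.sum_ite_eq, Algebra.algebraMap_self, MvPowerSeries.map_id, RingHom.id_apply,
          MvPolynomial.coeff_coe]
        split_ifs with hm
        · rfl
        · by_contra hne
          exact hm (hB j (MvPolynomial.mem_support_iff.mpr hne))
      rw [Algebra.smul_def, hcoe, Finset.sum_mul, map_sum]
      refine Finset.sum_congr rfl fun m _ => ?_
      rw [map_coeff_monomial_mul, map_pow])
  let Q : Polynomial (MvPowerSeries σ F) := ∑ j : Fin (d + 1), Polynomial.monomial (j : ℕ)
    (∑ m : B, MvPowerSeries.monomial m.1 (e (j, m)))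
  have hcoeff (j : Fin (d + 1)) :
      Q.coeff j = ∑ m : B, MvPowerSeries.monomial m.1 (e (j, m)) := by
    simp [Q, Polynomial.finsetSum_coeff, Polynomial.coeff_monomial, Fin.val_inj]
  have hcoeff' (j : Fin (d + 1)) (m : σ →₀ ℕ) : (Q.coeff j).coeff m =
      if hm : m ∈ B then e (j, ⟨m, hm⟩) else 0 := by
    rw [hcoeff, map_sum]
    simp only [MvPowerSeries.coeff_monomial]
    split_ifs with hm
    · rw [Finset.sum_eq_single ⟨m, hm⟩, if_pos rfl]
      · exact fun x _ hx => if_neg fun h => hx (Subtype.ext h.symm)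
      · exact fun h => absurd (Finset.mem_univ _) h
    · exact Finset.sum_eq_zero fun x _ => if_neg fun (h : m = x) => hm (h ▸ x.2)
  have hdeg : Q.natDegree ≤ d := Polynomial.natDegree_sum_le_of_forall_le _ _ fun j _ =>
    (Polynomial.natDegree_monomial_le _).trans (Nat.lt_succ_iff.mp j.2)
  refine ⟨Q, fun h0 => he0 (funext fun x => ?_), hdeg, fun j m hm => ?_, ?_⟩
  · have := hcoeff' x.1 x.2.1
    rw [h0, Polynomial.coeff_zero, map_zero, dif_pos x.2.2] at this
    exact this.symm
  · by_cases hj : d < j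
    · rw [Polynomial.coeff_eq_zero_of_natDegree_lt (hdeg.trans_lt hj), map_zero] at hm
      exact absurd rfl hm
    · have := hcoeff' ⟨j, by omega⟩ m
      by_contra hmB
      rw [dif_neg hmB] at this
      exact hm this
  · ext u
    rw [map_zero, ← he u, Polynomial.eval_finsetSum, map_sum, Fintype.sum_prod_type]
    refine Finset.sum_congr rfl fun j _ => ?_
    rw [Polynomial.eval_monomial, Finset.sum_mul, map_sum]
    refine Finset.sum_congr rfl fun m _ => ?_
    rw [map_coeff_monomial_mul, map_pow]

theorem isJacobsonRing_int : IsJacobsonRing ℤ := by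
  refine isJacobsonRing_iff_prime_eq.mpr fun P hP => ?_
  rcases eq_or_ne P ⊥ with rfl | hP0
  · refine le_antisymm (fun x hx => ?_) Ideal.le_jacobson
    -- The unit `x * x + 1` is `1` or `-1`, hence `x = 0`.
    have h := Int.isUnit_iff.mp (Ideal.mem_jacobson_bot.mp hx x)
    rw [Ideal.mem_bot]
    rcases h with h | h <;> nlinarith
  · have := hP.isMaximal hP0
    exact Ideal.jacobson_eq_self_of_isMaximal

theorem prime_and_finite_of_finite_int {F : Type*} [Field F] [Module.Finite ℤ F] (p : ℕ)
    [CharP F p] : p.Prime ∧ Finite F := by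
  have hp0 : p ≠ 0 := by
    rintro rfl
    have : CharZero F := CharP.charP_to_charZero F
    -- In characteristic zero, `F` would be integral over `ℤ`, and `ℤ` would be a field.
    exact Int.not_isField (isField_of_isIntegral_of_isField
      (FaithfulSMul.algebraMap_injective ℤ F) (Field.toIsField F))
  refine ⟨(CharP.char_is_prime_or_zero F p).resolve_right hp0, ?_⟩
  refine Module.finite_of_fg_torsion F fun {x} => ?_
  refine ⟨⟨(p : ℤ), mem_nonZeroDivisors_of_ne_zero (by exact_mod_cast hp0)⟩, ?_⟩
  change (p : ℤ) • x = 0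
  rw [zsmul_eq_mul, Int.cast_natCast, CharP.cast_eq_zero, zero_mul]

end Reduction
-- Exponents modulo `(1, …, 1)`.
section Counting

variable {n : ℕ}

theorem exists_eq_add_constExponent (hn : 1 ≤ n) (m : Fin n →₀ ℕ) :
    ∃ b ≤ m, (∃ i, b i = 0) ∧ ∃ k : ℕ, m = b + k • constExponent n 1 := by
  have : Nonempty (Fin n) := ⟨⟨0, hn⟩⟩
  obtain ⟨i, hi⟩ := Finite.exists_min m
  refine ⟨m - constExponent n (m i), tsub_le_self, ⟨i, by simp⟩, m i, ?_⟩
  ext j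
  simp [Nat.sub_add_cancel (hi j)]

/-- The representatives are the points of the box with a zero coordinate: the whole box minus the
points with all coordinates at least `1`. -/
theorem exists_representatives_box (hn : 1 ≤ n) (hs : Fin n → ℕ) :
    ∃ B₀ : Finset (Fin n →₀ ℕ), B₀.card = ∏ i, (hs i + 1) - ∏ i, hs i ∧
      ∀ m : Fin n →₀ ℕ, (∀ i, m i ≤ hs i) → ∃ b ∈ B₀, ∃ k : ℕ, m = b + k • constExponent n 1 := by
  classical
  refine ⟨(Fintype.piFinset (fun i => Finset.range (hs i + 1)) \
    Fintype.piFinset (fun i => Finset.Icc 1 (hs i))).map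
      Finsupp.equivFunOnFinite.symm.toEmbedding, ?_, fun m hm => ?_⟩
  · rw [Finset.card_map, Finset.card_sdiff_of_subset, Fintype.card_piFinset, Fintype.card_piFinset]
    · simp
    · refine Fintype.piFinset_subset _ _ fun i x hx => ?_
      rw [Finset.mem_Icc] at hx
      exact Finset.mem_range.mpr (by omega)
  · obtain ⟨b, hbm, ⟨i, hi⟩, k, hk⟩ := exists_eq_add_constExponent hn m
    refine ⟨b, ?_, k, hk⟩
    rw [Finset.mem_map_equiv, Finset.mem_sdiff, Fintype.mem_piFinset, Fintype.mem_piFinset]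
    refine ⟨fun j => Finset.mem_range.mpr (Nat.lt_succ_of_le ((hbm j).trans (hm j))), fun h => ?_⟩
    have := (Finset.mem_Icc.mp (h i)).1
    simp [hi] at this

/-- The exponents of degree at most `h`. -/
noncomputable def simplex (n h : ℕ) : Finset (Fin n →₀ ℕ) :=
  (Finset.range (h + 1)).biUnion fun s => Finset.finsuppAntidiag Finset.univ s

theorem mem_simplex {h : ℕ} {m : Fin n →₀ ℕ} : m ∈ simplex n h ↔ ∑ i, m i ≤ h := by
  simp [simplex, Finset.mem_finsuppAntidiag]

theorem card_simplex (hn : 1 ≤ n) (h : ℕ) : (simplex n h).card = (n + h).choose n := by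
  classical
  obtain ⟨n, rfl⟩ := Nat.exists_eq_add_of_le' hn
  rw [simplex, Finset.card_biUnion]
  · rw [show n + 1 + h = h + n + 1 by ring, ← Nat.sum_range_add_choose]
    refine Finset.sum_congr rfl fun s _ => ?_
    rw [Finset.card_finsuppAntidiag_nat_eq_choose, Finset.card_univ, Fintype.card_fin,
      show n + 1 + s - 1 = s + n by omega, Nat.choose_symm_add]
  · intro s _ t _ hst
    rw [Function.onFun, Finset.disjoint_left]
    intro m hm hm'
    rw [Finset.mem_finsuppAntidiag] at hm hm'
    exact hst (hm.1.symm.trans hm'.1)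

theorem exists_representatives_simplex (hn : 1 ≤ n) (h : ℕ) :
    ∃ B₀ : Finset (Fin n →₀ ℕ), B₀.card ≤ (n + h).choose n - h.choose n ∧
      ∀ m : Fin n →₀ ℕ, ∑ i, m i ≤ h → ∃ b ∈ B₀, ∃ k : ℕ, m = b + k • constExponent n 1 := by
  classical
  refine ⟨(simplex n h).filter fun b => ∃ i, b i = 0, ?_, fun m hm => ?_⟩
  · have hcard := Finset.card_filter_add_card_filter_not (s := simplex n h)
      (fun b => ∃ i, b i = 0)
    rw [card_simplex hn] at hcard
    -- Translation by `(1, …, 1)` embeds the simplex of size `h - n` into the points without zero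
    -- coordinate; for `h < n` the binomial coefficient is `0`.
    have hpos : h.choose n ≤ ((simplex n h).filter fun b => ¬ ∃ i, b i = 0).card := by
      rcases lt_or_ge h n with hlt | hle
      · rw [Nat.choose_eq_zero_of_lt hlt]
        exact Nat.zero_le _
      · obtain ⟨h, rfl⟩ := Nat.exists_eq_add_of_le hle
        rw [← card_simplex hn, ← Finset.card_map (addRightEmbedding (constExponent n 1))]
        refine Finset.card_le_card fun m hm => ?_
        obtain ⟨b, hb, rfl⟩ := Finset.mem_map.mp hm
        rw [mem_simplex] at hb
        rw [Finset.mem_filter, mem_simplex]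
        simp [Finset.sum_add_distrib]
        omega
    omega
  · obtain ⟨b, hbm, hi, k, hk⟩ := exists_eq_add_constExponent hn m
    refine ⟨b, Finset.mem_filter.mpr ⟨mem_simplex.mpr ?_, hi⟩, k, hk⟩
    exact (Finset.sum_le_sum fun i _ => hbm i).trans hm

theorem boundN_pos (hn : 1 ≤ n) (d h : ℕ) (hs : Fin n → ℕ) : 0 < boundN n d h hs := by
  refine Nat.mul_pos d.succ_pos (lt_min (Nat.sub_pos_of_lt ?_) (Nat.sub_pos_of_lt ?_))
  · by_cases h0 : ∀ i, 0 < hs i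
    · have : Nonempty (Fin n) := ⟨⟨0, hn⟩⟩
      exact Finset.prod_lt_prod_of_nonempty (fun i _ => h0 i) (fun i _ => Nat.lt_succ_self _)
        Finset.univ_nonempty
    · push Not at h0
      obtain ⟨i, hi⟩ := h0
      rw [Finset.prod_eq_zero (Finset.mem_univ i) (Nat.le_zero.mp hi)]
      exact Finset.prod_pos fun i _ => Nat.succ_pos _
  · obtain ⟨n, rfl⟩ := Nat.exists_eq_add_of_le' hn
    rw [show n + 1 + h = (n + h) + 1 by ring, Nat.choose_succ_succ]
    have h1 : 0 < (n + h).choose n := Nat.choose_pos (Nat.le_add_right _ _)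
    have h2 : h.choose (n + 1) ≤ (n + h).choose (n + 1) := Nat.choose_le_choose _ (by omega)
    simp only [Nat.succ_eq_add_one]
    omega

end Counting
-- From linear dependence to the linearized polynomial.
section Annihilator

open Polynomial

open scoped RatFunc

variable {F : Type*} [Field F]

instance charP_laurentSeries (p : ℕ) [CharP F p] : CharP (LaurentSeries F) p :=
  charP_of_injective_ringHom (f := (HahnSeries.C : F →+* HahnSeries ℤ F)) HahnSeries.C_injective p

theorem hasLinearizedAnnihilator_of_sum_eq_zero {p m D : ℕ} (hm : m ≤ D) {g : PowerSeries F}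
    {c : Fin (m + 1) → RatFunc F} (hc0 : c ≠ 0)
    (hc : ∑ i, c i • toLaurent g ^ p ^ (i : ℕ) = 0) : HasLinearizedAnnihilator p D g := by
  -- The degree of this auxiliary polynomial is the largest index with `c i ≠ 0`, which serves as
  -- the exact `p`-degree.
  let Q : (RatFunc F)[X] := ∑ i : Fin (m + 1), Polynomial.monomial (i : ℕ) (c i)
  have hQc (i : Fin (m + 1)) : Q.coeff i = c i := by
    simp [Q, finsetSum_coeff, coeff_monomial, Fin.val_inj]
  have hQ0 : Q ≠ 0 := fun h0 => hc0 (funext fun i => by rw [← hQc, h0, coeff_zero, Pi.zero_apply])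
  have hQd : Q.natDegree ≤ m := natDegree_sum_le_of_forall_le _ _ fun i _ =>
    (natDegree_monomial_le _).trans (Nat.lt_succ_iff.mp i.2)
  refine ⟨Q.natDegree, hQd.trans hm, _, ⟨Q.coeff, leadingCoeff_ne_zero.mpr hQ0, rfl⟩, ?_⟩
  rw [Annihilates, map_sum, ← hc]
  simp only [map_mul, aeval_C, map_pow, aeval_X, ← Algebra.smul_def]
  rw [← sum_over_range Q (f := fun i a => a • toLaurent g ^ p ^ i) (fun _ => zero_smul _ _),
    sum_over_range' Q (f := fun i a => a • toLaurent g ^ p ^ i) (fun _ => zero_smul _ _) (m + 1)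
      (Nat.lt_succ_of_le hQd), Finset.sum_range]
  simp only [hQc]

theorem HasLinearizedAnnihilator.isAlgebraicOfDegreeLE {p N : ℕ} (hp : p.Prime) (hN : 0 < N)
    {g : PowerSeries F} (h : HasLinearizedAnnihilator p N g) :
    IsAlgebraicOfDegreeLE g (p ^ N - 1) := by
  obtain ⟨M, hM, P, ⟨c, hcM, rfl⟩, hP⟩ := h
  have hpos (i : ℕ) : 0 < p ^ i := pow_pos hp.pos i
  let Q : (RatFunc F)[X] := ∑ i ∈ Finset.range (M + 1), C (c i) * X ^ (p ^ i - 1)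
  have hQ0 : Q ≠ 0 := fun h0 => by
    have := congrArg (coeff · (p ^ M - 1)) h0
    simp only [Q, finsetSum_coeff, coeff_C_mul, coeff_X_pow, coeff_zero] at this
    rw [Finset.sum_eq_single M] at this
    · simp [hcM] at this
    · intro i _ hi
      rw [if_neg, mul_zero]
      intro heq
      exact hi (Nat.pow_right_injective hp.two_le (show p ^ i = p ^ M by
        have := hpos i
        have := hpos M
        omega))
    · simp
  have hmul : X * Q = ∑ i ∈ Finset.range (M + 1), C (c i) * X ^ p ^ i := by
    rw [Finset.mul_sum]
    refine Finset.sum_congr rfl fun i _ => ?_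
    rw [mul_left_comm, ← pow_succ', Nat.sub_add_cancel (hpos i)]
  rw [Annihilates, ← hmul] at hP
  refine ⟨⟨X * Q, mul_ne_zero X_ne_zero hQ0, hP⟩, ?_⟩
  rw [map_mul, aeval_X] at hP
  rcases mul_eq_zero.mp hP with h0 | h0
  -- Dividing by `X` loses the root `0`; a zero series has degree `1`, and `1 ≤ p ^ N - 1` because
  -- `N > 0`.
  · rw [h0, minpoly.zero, natDegree_X]
    have := Nat.pow_le_pow_left hp.two_le N
    have := Nat.pow_le_pow_right (show 0 < 2 by decide) hN
    omega
  · refine (natDegree_le_natDegree (minpoly.degree_le_of_ne_zero _ _ hQ0 h0)).trans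
      (natDegree_sum_le_of_forall_le _ _ fun i hi => (natDegree_C_mul_X_pow_le _ _).trans ?_)
    exact Nat.sub_le_sub_right (Nat.pow_le_pow_right hp.pos
      ((Nat.lt_succ_iff.mp (Finset.mem_range.mp hi)).trans hM)) 1

/-- The diagonal of an algebraic power series over a perfect field of characteristic `p` is killed
by a linearized polynomial whose `p`-degree is controlled by the exponents of an equation. -/
theorem hasLinearizedAnnihilator_diagonal (p : ℕ) [Fact p.Prime] [CharP F p] [PerfectRing F p]
    {n : ℕ} (hn : 1 ≤ n) {ι : Type*} {ω : ι → (Fin n →₀ ℕ) →+ ℕ} {H : ι → ℕ}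
    {B₀ : Finset (Fin n →₀ ℕ)} (hfin : {m | ∀ i, ω i m ≤ H i}.Finite)
    (hB₀ : ∀ m, (∀ i, ω i m ≤ H i) → ∃ b ∈ B₀, ∃ k : ℕ, m = b + k • constExponent n 1)
    {d : ℕ} {f : MvPowerSeries (Fin n) F}
    (h : ∃ E : (MvPowerSeries (Fin n) F)[X], E ≠ 0 ∧ E.natDegree ≤ d ∧
      (∀ j, SupportBounded ω H (E.coeff j)) ∧ E.eval f = 0) :
    HasLinearizedAnnihilator p ((d + 1) * B₀.card) (diagonal f) := by
  obtain ⟨E, hEd, hEb, hEf, hder⟩ := exists_eval_derivative_ne_zero p h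
  let s := (fun w => toLaurent (diagonal w)) '' residueSpace ω H d E f
  have hfrob : ∀ x ∈ s, x ∈ Submodule.span (RatFunc F) ((fun y => y ^ p) '' s) := by
    rintro _ ⟨w, hw, rfl⟩
    dsimp only
    rw [diagonal_eq_sum_cartier p w, toLaurent, map_sum]
    refine sum_mem fun r hr => ?_
    have := toLaurent_polynomial_mul (X ^ r : F[X])
      (diagonal (cartier p (constExponent n r) w) ^ p)
    rw [coe_pow, coe_X, toLaurent, toLaurent] at this
    rw [this]
    refine Submodule.smul_mem _ _ (Submodule.subset_span ⟨_, ⟨_, ?_, rfl⟩, (map_pow _ _ _).symm⟩)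
    exact cartier_mem_residueSpace p hEd hEb hEf (fun _ => Finset.mem_range.mp hr) hw
  have hdep : ∀ v : Fin ((d + 1) * B₀.card + 1) → LaurentSeries F, (∀ i, v i ∈ s) →
      ¬ LinearIndependent (RatFunc F) v := by
    intro v hv
    choose w hw hwv using hv
    obtain rfl : (fun i => toLaurent (diagonal (w i))) = v := funext hwv
    exact not_linearIndependent_toLaurent_diagonal hn
      (exists_dependence_residueSpace hfin hB₀ hder (by rw [Fintype.card_fin]; omega) hw)
  obtain ⟨m, hm, c, hc0, hc⟩ := exists_sum_smul_pow_eq_zero p hfrob hdep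
    ⟨f, self_mem_residueSpace hEd hEb, rfl⟩
  exact hasLinearizedAnnihilator_of_sum_eq_zero hm hc0 hc

/-- The reduction of a power series satisfying an equation over an extension `k` of `Z`: the bound
on the `p`-degree is read off from the exponents of that equation. -/
theorem hasLinearizedAnnihilator_diagonal_map (p : ℕ) [Fact p.Prime] [CharP F p]
    [PerfectRing F p] {Z k : Type*} [CommRing Z] [Field k] {φ : Z →+* k}
    (hφ : Function.Injective φ) (π : Z →+* F) {n : ℕ} (hn : 1 ≤ n) {ι : Type*}
    {ω : ι → (Fin n →₀ ℕ) →+ ℕ} {H : ι → ℕ} {B₀ : Finset (Fin n →₀ ℕ)}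
    (hfin : {m | ∀ i, ω i m ≤ H i}.Finite)
    (hB₀ : ∀ m, (∀ i, ω i m ≤ H i) → ∃ b ∈ B₀, ∃ k : ℕ, m = b + k • constExponent n 1)
    (f : MvPowerSeries (Fin n) Z) {E : Polynomial (MvPolynomial (Fin n) k)} (hE0 : E ≠ 0)
    (hE : aeval (MvPowerSeries.map φ f) E = 0)
    (hH : ∀ j, ∀ m ∈ (E.coeff j).support, ∀ i, ω i m ≤ H i) :
    HasLinearizedAnnihilator p ((E.natDegree + 1) * B₀.card)
      (diagonal (MvPowerSeries.map π f)) := by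
  obtain ⟨Q, hQ0, hQd, hQB, hQ⟩ := exists_reduced_equation hφ π f hE0 hE (B := hfin.toFinset)
    fun j m hm => hfin.mem_toFinset.mpr (hH j m hm)
  exact hasLinearizedAnnihilator_diagonal p hn hfin hB₀
    ⟨Q, hQ0, hQd, fun j m hm => hfin.mem_toFinset.mp (hQB j m hm), hQ⟩

theorem HasLinearizedAnnihilator.mono {p N N' : ℕ} {g : PowerSeries F}
    (h : HasLinearizedAnnihilator p N g) (hN : N ≤ N') : HasLinearizedAnnihilator p N' g :=
  let ⟨M, hM, hP⟩ := h
  ⟨M, hM.trans hN, hP⟩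

theorem hasLinearizedAnnihilator_boundN (p : ℕ) [Fact p.Prime] [CharP F p] [PerfectRing F p]
    {Z k : Type*} [CommRing Z] [Field k] {φ : Z →+* k} (hφ : Function.Injective φ) (π : Z →+* F)
    {n : ℕ} (hn : 1 ≤ n) (f : MvPowerSeries (Fin n) Z) {d h : ℕ} {hs : Fin n → ℕ}
    (hdeg : HasDegreeAndHeights (MvPowerSeries.map φ f) d h hs) :
    HasLinearizedAnnihilator p (boundN n d h hs) (diagonal (MvPowerSeries.map π f)) := by
  obtain ⟨E, ⟨hE0, hE, -⟩, rfl, rfl, hhs⟩ := hdeg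
  rw [boundN]
  rcases min_choice (∏ i, (hs i + 1) - ∏ i, hs i)
    ((n + totalDegreeT E).choose n - (totalDegreeT E).choose n) with hmin | hmin
  · obtain ⟨B₀, hcard, hB₀⟩ := exists_representatives_box hn hs
    rw [hmin, ← hcard]
    -- Partial heights use the `n` coordinates as weights; the total height below uses the single
    -- weight `Finsupp.degree`.
    refine hasLinearizedAnnihilator_diagonal_map p hφ π hn (ω := Finsupp.applyAddHom) (H := hs)
      ?_ hB₀ f hE0 hE fun j m hm i => ?_
    · refine (Set.finite_Iic (Finsupp.equivFunOnFinite.symm hs)).subset fun m hm i => ?_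
      exact hm i
    · rw [← hhs i]
      refine (MvPolynomial.monomial_le_degreeOf i hm).trans
        (Finset.le_sup (f := fun j => (E.coeff j).degreeOf i) (mem_support_iff.mpr ?_))
      rintro h0
      simp [h0] at hm
  · obtain ⟨B₀, hcard, hB₀⟩ := exists_representatives_simplex hn (totalDegreeT E)
    rw [hmin]
    refine HasLinearizedAnnihilator.mono (hasLinearizedAnnihilator_diagonal_map p hφ π hn
      (ω := fun _ : Unit => Finsupp.degree) (H := fun _ => totalDegreeT E) (B₀ := B₀)
      ?_ (fun m hm => hB₀ m ?_) f hE0 hE fun j m hm i => ?_) (Nat.mul_le_mul_left _ hcard)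
    · refine (simplex n (totalDegreeT E)).finite_toSet.subset fun m hm => ?_
      rw [Finset.mem_coe, mem_simplex, ← Finsupp.degree_eq_sum]
      exact hm ()
    · rw [← Finsupp.degree_eq_sum]
      exact hm ()
    · refine (MvPolynomial.le_totalDegree hm).trans
        (Finset.le_sup (f := fun j => (E.coeff j).totalDegree) (mem_support_iff.mpr ?_))
      rintro h0
      simp [h0] at hm

end Annihilator

end DiagonalModP

theorem theorem1p4 {k : Type*} [Field k] [CharZero k]
    (Z : Subalgebra ℤ k) (hZ : Z.FG)
    {n : ℕ} (hn : 1 ≤ n) (f : MvPowerSeries (Fin n) Z)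
    (hf : IsAlgebraic (MvPolynomial (Fin n) k) (MvPowerSeries.map (algebraMap Z k) f))
    (d h : ℕ) (hs : Fin n → ℕ)
    (hdeg : DiagonalModP.HasDegreeAndHeights (MvPowerSeries.map (algebraMap Z k) f) d h hs)
    (𝔭 : Ideal Z) [𝔭.IsMaximal] (p : ℕ) [CharP (Z ⧸ 𝔭) p] :
    letI : Field (Z ⧸ 𝔭) := Ideal.Quotient.field 𝔭
    DiagonalModP.HasLinearizedAnnihilator p (DiagonalModP.boundN n d h hs)
        (DiagonalModP.reduction 𝔭 (DiagonalModP.diagonal f)) ∧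
      DiagonalModP.IsAlgebraicOfDegreeLE (DiagonalModP.reduction 𝔭 (DiagonalModP.diagonal f))
        (p ^ DiagonalModP.boundN n d h hs - 1) := by
  let _ : Field (Z ⧸ 𝔭) := Ideal.Quotient.field 𝔭
  have := DiagonalModP.isJacobsonRing_int
  have : Algebra.FiniteType ℤ Z := Z.fg_iff_finiteType.mp hZ
  -- By the Nullstellensatz over the Jacobson ring `ℤ`, a field of finite type is a finite module.
  have : Module.Finite ℤ (Z ⧸ 𝔭) := finite_of_finite_type_of_isJacobsonRing ℤ (Z ⧸ 𝔭)
  obtain ⟨hp, _⟩ := DiagonalModP.prime_and_finite_of_finite_int (F := Z ⧸ 𝔭) p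
  have : Fact p.Prime := ⟨hp⟩
  have hred : DiagonalModP.reduction 𝔭 (DiagonalModP.diagonal f) =
      DiagonalModP.diagonal (MvPowerSeries.map (Ideal.Quotient.mk 𝔭) f) := by
    ext i
    rw [DiagonalModP.reduction, PowerSeries.coeff_map, DiagonalModP.coeff_diagonal,
      DiagonalModP.coeff_diagonal, MvPowerSeries.coeff_map]
  rw [hred]
  have hann := DiagonalModP.hasLinearizedAnnihilator_boundN p
    (FaithfulSMul.algebraMap_injective Z k) (Ideal.Quotient.mk 𝔭) hn f hdeg
  exact ⟨hann, hann.isAlgebraicOfDegreeLE hp (DiagonalModP.boundN_pos hn d h hs)⟩
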